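/- For a rational number $\alpha$ let $r_\alpha\ge 1$ be its denominator in lowest terms and put $\Delta_\alpha=\frac12\left(1-\frac1{r_\alpha^2}\right)$. For rational $\alpha,\beta$ with $3+\alpha-\beta\ne 0$ put $$\alpha.\beta=\frac{\alpha+\beta}2+\frac{\Delta_\beta-\Delta_\alpha}{3+\alpha-\beta}.$$ Define $\varepsilon:\mathbb Z[\tfrac12]\to\mathbb Q$ inductively by $\varepsilon(n)=n$ for $n\in\mathbb Z$ and $\varepsilon\left(\frac{2p+1}{2^{q}}\right)=\varepsilon\left(\frac p{2^{q-1}}\right).\,\varepsilon\left(\frac{p+1}{2^{q-1}}\right)$ for $p\in\mathbb Z$, $q\ge 1$, and let $\mathfrak E=\varepsilon(\mathbb Z[\tfrac12])$ (this is the set of slopes of exceptional bundles on $\mathbb P^2$). For $\alpha\in\mathfrak E$ let $$x_\alpha=\frac32-\sqrt{\frac94-\frac1{r_\alpha^2}},\qquad I_\alpha=(\alpha-x_\alpha,\alpha+x_\alpha)\subset\mathbb R,$$ and let $C=\mathbb R\setminus\bigcup_{\alpha\in\mathfrak E}I_\alpha$ be the generalized Cantor set. Let $P(x)=\frac12(x^2+3x+2)$,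 let $\delta(\mu)=P(-|\mu-\alpha|)-\Delta_\alpha$ for $\mu\in I_\alpha$, $\alpha\in\mathfrak E$, extended to $\mathbb R$ by $\delta(\xi)=\frac12$ for $\xi\in C$, and let $\gamma(\mu)=P(\mu)-\delta(\mu)$. **Theorem.** Every rational number lies in $I_\alpha$ for exactly one $\alpha\in\mathfrak E$ (so $\delta$ and $\gamma$ are well defined, and they take rational values at rational numbers), and $\gamma$ restricts to a bijection $\mathbb Q_{\ge 0}\to\mathbb Q_{\ge 0}$. Moreover, $\gamma$ is a continuous bijection $\mathbb R_{\ge 0}\to\mathbb R_{\ge 0}$, and for every $q\in\mathbb Q_{\ge 0}$ the number $\gamma^{-1}(q)$ does not lie in $C$. -/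

import Mathlib

namespace ExceptionalSlopes

noncomputable section

/-- The Hilbert polynomial `P(x) = (x² + 3x + 2)/2` of the structure sheaf of the plane,
over any field (used over `ℚ` and over `ℝ`). -/
def P {K : Type*} [Field K] (x : K) : K := (x ^ 2 + 3 * x + 2) / 2

/-- The discriminant `Δ_α = (1 - 1/r_α²)/2`, where `r_α = α.den` is the denominator of `α` in
lowest terms. -/
def disc (α : ℚ) : ℚ := (1 - 1 / (α.den : ℚ) ^ 2) / 2

/-- The operation `α.β = (α + β)/2 + (Δ_β - Δ_α)/(3 + α - β)`. -/
def dot (α β : ℚ) : ℚ := (α + β) / 2 + (disc β - disc α) / (3 + α - β)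

/-- `eps p q` is the value `ε(p/2^q)` of the map `ε` from the dyadic rationals to the exceptional
slopes: `ε(n) = n` for integers `n`, and
`ε((2p+1)/2^(q+1)) = ε(p/2^q).ε((p+1)/2^q)`. If the numerator is even the fraction is reduced. -/
def eps : ℤ → ℕ → ℚ
  | p, 0 => (p : ℚ)
  | p, q + 1 => if p % 2 = 0 then eps (p / 2) q else dot (eps (p / 2) q) (eps (p / 2 + 1) q)

theorem eps_zero (n : ℤ) : eps n 0 = n := rfl

theorem eps_even (p : ℤ) (q : ℕ) : eps (2 * p) (q + 1) = eps p q := by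
  simp [eps]

theorem eps_odd (p : ℤ) (q : ℕ) :
    eps (2 * p + 1) (q + 1) = dot (eps p q) (eps (p + 1) q) := by
  have h1 : (2 * p + 1) % 2 = 1 := by omega
  have h2 : (2 * p + 1) / 2 = p := by omega
  simp [eps, h1, h2]

theorem eps_shift (p : ℤ) (q k : ℕ) : eps (2 ^ k * p) (q + k) = eps p q := by
  induction k with
  | zero => simp
  | succ k ih =>
    rw [pow_succ', mul_assoc, ← add_assoc, eps_even, ih]

/-- `eps p q` depends only on the dyadic rational `p/2^q`. -/
theorem eps_congr {p p' : ℤ} {q q' : ℕ} (h : (p : ℚ) / 2 ^ q = (p' : ℚ) / 2 ^ q') :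
    eps p q = eps p' q' := by
  have h' : (2 : ℤ) ^ q' * p = 2 ^ q * p' := by
    rw [div_eq_div_iff (by positivity) (by positivity)] at h
    have : (2 : ℚ) ^ q' * p = 2 ^ q * p' := by linarith
    exact_mod_cast this
  rw [← eps_shift p q q', ← eps_shift p' q' q, h', add_comm]

/-- The set of exceptional slopes: the image of `ε`. -/
def exceptionalSlopes : Set ℚ := {α | ∃ (p : ℤ) (q : ℕ), eps p q = α}

/-- `x_α = 3/2 - √(9/4 - 1/r_α²)`. -/
def xRadius (α : ℚ) : ℝ := 3 / 2 - √(9 / 4 - 1 / (α.den : ℝ) ^ 2)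

/-- The open interval `I_α = (α - x_α, α + x_α)`. -/
def I (α : ℚ) : Set ℝ := Set.Ioo ((α : ℝ) - xRadius α) ((α : ℝ) + xRadius α)

/-- The generalized Cantor set, the complement of the union of the `I_α` over all exceptional
slopes `α`. -/
def cantorSet : Set ℝ := (⋃ α ∈ exceptionalSlopes, I α)ᶜ

/-- The exceptional slope associated to a real number that lies in some `I_α`. -/
def assocSlope (x : ℝ) (h : ∃ α : ℚ, α ∈ exceptionalSlopes ∧ x ∈ I α) : ℚ := h.choose

theorem assocSlope_mem (x : ℝ) (h : ∃ α : ℚ, α ∈ exceptionalSlopes ∧ x ∈ I α) :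
    assocSlope x h ∈ exceptionalSlopes ∧ x ∈ I (assocSlope x h) := h.choose_spec

open Classical in
/-- `δ : ℚ → ℚ`, `δ(μ) = P(-|μ - α|) - Δ_α` if `μ ∈ I_α` with `α` exceptional. (Every rational
number lies in exactly one `I_α`, so that the last branch is never taken.) -/
def delta (μ : ℚ) : ℚ :=
  if h : ∃ α : ℚ, α ∈ exceptionalSlopes ∧ (μ : ℝ) ∈ I α then
    P (-|μ - assocSlope μ h|) - disc (assocSlope μ h)
  else 1 / 2

open Classical in
/-- The extension of `δ` to the real line: the same formula on the intervals `I_α`, and the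
value `1/2` on the generalized Cantor set. -/
def deltaReal (x : ℝ) : ℝ :=
  if h : ∃ α : ℚ, α ∈ exceptionalSlopes ∧ x ∈ I α then
    P (-|x - (assocSlope x h : ℝ)|) - (disc (assocSlope x h) : ℝ)
  else 1 / 2

/-- `γ(μ) = P(μ) - δ(μ)` on the rational numbers. -/
def gamma (μ : ℚ) : ℚ := P μ - delta μ

/-- The extension of `γ` to the real numbers. -/
def gammaReal (x : ℝ) : ℝ := P x - deltaReal x

theorem deltaReal_ratCast (μ : ℚ) : deltaReal (μ : ℝ) = (delta μ : ℝ) := by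
  unfold deltaReal delta
  split_ifs with h
  · simp only [P]
    push_cast
    rfl
  · norm_num

theorem gammaReal_ratCast (μ : ℚ) : gammaReal (μ : ℝ) = (gamma μ : ℝ) := by
  unfold gammaReal gamma
  rw [deltaReal_ratCast]
  simp only [P]
  push_cast
  rfl

theorem deltaReal_of_mem_cantorSet {x : ℝ} (hx : x ∈ cantorSet) : deltaReal x = 1 / 2 := by
  unfold deltaReal
  rw [dif_neg]
  rintro ⟨α, hα, hxα⟩
  exact hx (Set.mem_biUnion hα hxα)

end

end ExceptionalSlopes

namespace ExceptionalSlopes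

open Filter Topology

/-! ### Integral classes of exceptional slopes and their mutations -/

/-! Neighbours `α < β` at any dyadic level are slopes of integral classes of Euler square one with
χ(β, α) = 0. This property passes to (α, α.β) and (α.β, β), and it gives (β - α)(3 - (β - α)) =
1/r_α² + 1/r_β². Since x_α(3 - x_α) = 1/r_α², the intervals `I α` are disjoint (`add_xRadius_lt`).

On the real line, δ is 3/2-Lipschitz while P has slope x + 3/2, so γ is continuous, strictly
increasing and unbounded on x ≥ 0. On each half of `I α` the quadratic terms of γ cancel, leaving an
affine function with rational coefficients. A nonnegative preimage of a rational is therefore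
rational as soon as it lies in some `I α`.

It remains to keep rational points, and nonnegative preimages of rationals, out of the Cantor set. A
point ξ of it that is not an endpoint has exceptional slopes α → ξ with r_α²(ξ - α) → 1/3. This is
too close for a rational ξ. If γ(ξ) is rational then δ(ξ) = 1/2 makes ξ² + 3ξ rational, and the same
approximation yields a convergent sequence of integers, which forces ξ to be rational. Endpoints are
excluded because 9r² - 4 is never a square. -/

/-- `α = a / r` is the slope of an integral class `(r, a, k)` whose Euler square is one. -/
def IsUnitClass (α : ℚ) (k : ℤ) : Prop :=
  (α.den : ℤ) ^ 2 - α.num ^ 2 + α.den * (α.num + 2 * k) = 1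

/-- The Euler pairing of the class of `β` with the class of `α` vanishes. -/
def IsOrth (α : ℚ) (k : ℤ) (β : ℚ) (l : ℤ) : Prop :=
  (β.den : ℤ) * α.den + 2 * α.num * β.den - β.num * α.den - α.num * β.num + β.den * k +
    α.den * l = 0

/-- Two slopes `α < β` at distance at most one whose integral classes are orthogonal. -/
def IsExcPair (α β : ℚ) : Prop :=
  ∃ k l : ℤ, IsUnitClass α k ∧ IsUnitClass β l ∧ IsOrth α k β l ∧ α < β ∧ β - α ≤ 1

theorem norm_mutation {r a k s b l : ℤ} (hα : r ^ 2 - a ^ 2 + r * (a + 2 * k) = 1)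
    (hβ : s ^ 2 - b ^ 2 + s * (b + 2 * l) = 1)
    (h : s * r + 2 * a * s - b * r - a * b + s * k + r * l = 0) :
    (3 * r * s + a * s - b * r) ^ 2 - (b * r + 2 * a * s + k * s - l * r) ^ 2
      + (3 * r * s + a * s - b * r) * ((b * r + 2 * a * s + k * s - l * r) +
        2 * (-3 * r * s + 2 * b * r - 5 * a * s + 3 * a * b - 2 * k * s - r * l + k * b - a * l)) =
      1 := by
  grind

/-- Riemann–Roch in terms of slopes: χ(β, α) = 0 reads P(α - β) = Δ_α + Δ_β. -/
theorem IsOrth.sub_mul {α β : ℚ} {k l : ℤ} (hα : IsUnitClass α k) (hβ : IsUnitClass β l)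
    (h : IsOrth α k β l) :
    (β - α) * (3 - (β - α)) = 1 / (α.den : ℚ) ^ 2 + 1 / (β.den : ℚ) ^ 2 := by
  have hr : (α.den : ℚ) ≠ 0 := by exact_mod_cast α.den_nz
  have hs : (β.den : ℚ) ≠ 0 := by exact_mod_cast β.den_nz
  have h1 : (α.den : ℚ) ^ 2 - (α.num : ℚ) ^ 2 + α.den * (α.num + 2 * k) = 1 := by
    exact_mod_cast hα
  have h2 : (β.den : ℚ) ^ 2 - (β.num : ℚ) ^ 2 + β.den * (β.num + 2 * l) = 1 := by
    exact_mod_cast hβ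
  have h3 : (β.den : ℚ) * α.den + 2 * α.num * β.den - β.num * α.den - α.num * β.num +
      β.den * k + α.den * l = 0 := by exact_mod_cast h
  have e1 : α = α.num / α.den := (Rat.num_div_den α).symm
  have e2 : β = β.num / β.den := (Rat.num_div_den β).symm
  generalize (α.den : ℚ) = r at *
  generalize (β.den : ℚ) = s at *
  generalize (α.num : ℚ) = a at *
  generalize (β.num : ℚ) = b at *
  subst e1 e2
  field_simp
  linear_combination (-2 * r * s) * h3 + s ^ 2 * h1 + r ^ 2 * h2

theorem dot_sub_left {α β : ℚ} (h3 : β - α ≠ 3)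
    (h : (β - α) * (3 - (β - α)) = 1 / (α.den : ℚ) ^ 2 + 1 / (β.den : ℚ) ^ 2) :
    dot α β - α = 1 / ((α.den : ℚ) ^ 2 * (3 - (β - α))) := by
  have hr : (α.den : ℚ) ≠ 0 := by exact_mod_cast α.den_nz
  have hs : (β.den : ℚ) ≠ 0 := by exact_mod_cast β.den_nz
  have h3' : 3 - (β - α) ≠ 0 := fun h => h3 (by linarith)
  have h3'' : 3 + α - β ≠ 0 := fun h => h3 (by linarith)
  have hs2 : 1 / (β.den : ℚ) ^ 2 = (β - α) * (3 - (β - α)) - 1 / (α.den : ℚ) ^ 2 := by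
    linarith
  unfold dot disc
  rw [hs2]
  field_simp
  ring

theorem sub_dot_right {α β : ℚ} (h3 : β - α ≠ 3)
    (h : (β - α) * (3 - (β - α)) = 1 / (α.den : ℚ) ^ 2 + 1 / (β.den : ℚ) ^ 2) :
    β - dot α β = 1 / ((β.den : ℚ) ^ 2 * (3 - (β - α))) := by
  have hr : (α.den : ℚ) ≠ 0 := by exact_mod_cast α.den_nz
  have hs : (β.den : ℚ) ≠ 0 := by exact_mod_cast β.den_nz
  have h3' : 3 - (β - α) ≠ 0 := fun h => h3 (by linarith)
  have h3'' : 3 + α - β ≠ 0 := fun h => h3 (by linarith)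
  have hs2 : 1 / (α.den : ℚ) ^ 2 = (β - α) * (3 - (β - α)) - 1 / (β.den : ℚ) ^ 2 := by
    linarith
  unfold dot disc
  rw [hs2]
  field_simp
  ring

/-- The unit equation is itself a Bézout relation for u and t, so the rank of a unit class is the
reduced denominator of its slope. -/
theorem num_den_of_unit {u t m : ℤ} (ht : 0 < t) (h : t ^ 2 - u ^ 2 + t * (u + 2 * m) = 1) :
    ((u : ℚ) / t).num = u ∧ (((u : ℚ) / t).den : ℤ) = t := by
  have hc : IsCoprime u t := ⟨-u, t + u + 2 * m, by linear_combination h⟩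
  have hc' : Nat.Coprime u.natAbs t.natAbs := Int.isCoprime_iff_gcd_eq_one.1 hc
  exact ⟨Rat.num_div_eq_of_coprime ht hc', Rat.den_div_eq_of_coprime ht hc'⟩

theorem IsExcPair.mutation {α β : ℚ} (hp : IsExcPair α β) :
    IsExcPair α (dot α β) ∧ IsExcPair (dot α β) β ∧
      ((dot α β).den : ℚ) = α.den * β.den * (3 - (β - α)) := by
  obtain ⟨k, l, hα, hβ, ho, hlt, hle⟩ := hp
  have hr : (0 : ℤ) < α.den := by exact_mod_cast α.den_pos
  have hs : (0 : ℤ) < β.den := by exact_mod_cast β.den_pos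
  have hrQ : (0 : ℚ) < α.den := by exact_mod_cast α.den_pos
  have hsQ : (0 : ℚ) < β.den := by exact_mod_cast β.den_pos
  have hy := ho.sub_mul hα hβ
  have hne : β - α ≠ 3 := by linarith
  have hl := dot_sub_left hne hy
  have hR := sub_dot_right hne hy
  have e1 : α = α.num / α.den := (Rat.num_div_den α).symm
  -- Up to sign, (t, u, m) is the cross product of the linear forms χ(·, α) and χ(β, ·), hence
  -- orthogonal to both classes as required; `norm_mutation` says that it is again a unit class.
  obtain ⟨t, ht⟩ : ∃ t : ℤ, t = 3 * α.den * β.den + α.num * β.den - β.num * α.den := ⟨_, rfl⟩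
  obtain ⟨u, hu⟩ : ∃ u : ℤ, u = β.num * α.den + 2 * α.num * β.den + k * β.den - l * α.den :=
    ⟨_, rfl⟩
  obtain ⟨m, hm⟩ : ∃ m : ℤ, m = -3 * α.den * β.den + 2 * β.num * α.den - 5 * α.num * β.den +
    3 * α.num * β.num - 2 * k * β.den - α.den * l + k * β.num - α.num * l := ⟨_, rfl⟩
  have hT : t ^ 2 - u ^ 2 + t * (u + 2 * m) = 1 := by
    rw [ht, hu, hm]; exact norm_mutation hα hβ ho
  have htQ : (t : ℚ) = α.den * β.den * (3 - (β - α)) := by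
    rw [ht]
    push_cast
    linear_combination (-β.den : ℚ) * α.mul_den_eq_num + (α.den : ℚ) * β.mul_den_eq_num
  have htpos : 0 < t := by
    have : (0 : ℚ) < t := by
      rw [htQ]
      have : 0 < 3 - (β - α) := by linarith
      positivity
    exact_mod_cast this
  have hdot : dot α β = (u : ℚ) / t := by
    have h1 : (α.den : ℚ) ^ 2 - (α.num : ℚ) ^ 2 + α.den * (α.num + 2 * k) = 1 := by
      exact_mod_cast hα
    have h3 : (β.den : ℚ) * α.den + 2 * α.num * β.den - β.num * α.den - α.num * β.num +
      β.den * k + α.den * l = 0 := by exact_mod_cast ho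
    have ht0 : (t : ℚ) ≠ 0 := by exact_mod_cast htpos.ne'
    have e3 : 1 / ((α.den : ℚ) ^ 2 * (3 - (β - α))) = β.den / (α.den * t) := by
      have h3' : 3 - (β - α) ≠ 0 := fun h => hne (by linarith)
      rw [htQ]
      field_simp
    rw [e3] at hl
    have : dot α β = α + β.den / (α.den * t) := by linarith
    rw [this]
    nth_rewrite 1 [e1]
    have htq : (t : ℚ) = 3 * α.den * β.den + α.num * β.den - β.num * α.den := by
      rw [ht]; push_cast; ring
    have huq : (u : ℚ) = β.num * α.den + 2 * α.num * β.den + k * β.den - l * α.den := by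
      rw [hu]; push_cast; ring
    field_simp
    rw [huq, htq]
    linear_combination (α.den : ℚ) * h3 - β.den * h1
  obtain ⟨hnum, hden⟩ := num_den_of_unit htpos hT
  rw [← hdot] at hnum hden
  have h3 : 0 < 3 - (β - α) := by linarith
  have hl' : 0 < dot α β - α := by rw [hl]; positivity
  have hR' : 0 < β - dot α β := by rw [hR]; positivity
  have hU : IsUnitClass (dot α β) m := by rw [IsUnitClass, hnum, hden]; exact hT
  refine ⟨⟨k, m, hα, hU, ?_, by linarith, by linarith⟩, ⟨m, l, hU, hβ, ?_, by linarith,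
    by linarith⟩, ?_⟩
  · rw [IsOrth, hnum, hden, ht, hu, hm]
    ring
  · rw [IsOrth, hnum, hden, ht, hu, hm]
    ring
  · rw [← htQ]
    exact_mod_cast hden

theorem isExcPair_int (n : ℤ) : IsExcPair n (n + 1) := by
  have e : ((n : ℚ) + 1) = ((n + 1 : ℤ) : ℚ) := by push_cast; ring
  have h1 : ∀ j : ℤ, ∃ i, IsUnitClass (j : ℚ) i ∧ 2 * i = j * (j - 1) := by
    intro j
    obtain ⟨c, hc⟩ := Int.even_mul_succ_self (j - 1)
    refine ⟨c, ?_, by linear_combination -hc⟩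
    rw [IsUnitClass, Rat.num_intCast, Rat.den_intCast]
    push_cast
    linear_combination -hc
  obtain ⟨k, hk, hk'⟩ := h1 n
  obtain ⟨l, hl, hl'⟩ := h1 (n + 1)
  rw [e]
  refine ⟨k, l, hk, hl, ?_, by push_cast; linarith, by push_cast; linarith⟩
  rw [IsOrth, Rat.num_intCast, Rat.den_intCast, Rat.num_intCast, Rat.den_intCast]
  push_cast
  have : 2 * (k + l) = 2 * n ^ 2 := by linear_combination hk' + hl'
  linarith

theorem isExcPair_eps (p : ℤ) (q : ℕ) : IsExcPair (eps p q) (eps (p + 1) q) := by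
  induction q generalizing p with
  | zero => simpa [eps_zero] using isExcPair_int p
  | succ q ih =>
    obtain ⟨c, rfl | rfl⟩ := Int.even_or_odd' p
    · rw [eps_even, eps_odd]
      exact (ih c).mutation.1
    · rw [eps_odd, show 2 * c + 1 + 1 = 2 * (c + 1) by ring, eps_even]
      exact (ih c).mutation.2.1

theorem IsExcPair.sub_mul {α β : ℚ} (h : IsExcPair α β) :
    (β - α) * (3 - (β - α)) = 1 / (α.den : ℚ) ^ 2 + 1 / (β.den : ℚ) ^ 2 := by
  obtain ⟨k, l, hα, hβ, ho, -⟩ := h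
  exact ho.sub_mul hα hβ

theorem IsExcPair.sub_le_one {α β : ℚ} (h : IsExcPair α β) : β - α ≤ 1 := by
  obtain ⟨k, l, -, -, -, -, h⟩ := h
  exact h

/-- The factor 3 - (β - α) in the denominator of α.β is at least 2. This drives the growth of
denominators down the dyadic tree. -/
theorem IsExcPair.two_mul_den_le {α β : ℚ} (h : IsExcPair α β) :
    2 * α.den * β.den ≤ (dot α β).den := by
  have h1 := h.mutation.2.2
  have h2 := h.sub_le_one
  have : (2 * α.den * β.den : ℚ) ≤ (dot α β).den := by
    rw [h1]
    have : (0 : ℚ) ≤ α.den * β.den := by positivity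
    nlinarith
  exact_mod_cast this

/-! ### The intervals `I α` -/

theorem one_div_den_sq_pos (α : ℚ) : 0 < 1 / (α.den : ℝ) ^ 2 := by
  have : (0 : ℝ) < α.den := by exact_mod_cast α.den_pos
  positivity

theorem one_div_den_sq_le_one (α : ℚ) : 1 / (α.den : ℝ) ^ 2 ≤ 1 := by
  have : (1 : ℝ) ≤ α.den := by exact_mod_cast α.den_pos
  rw [div_le_one (by positivity)]
  nlinarith

theorem xRadius_mul (α : ℚ) : xRadius α * (3 - xRadius α) = 1 / (α.den : ℝ) ^ 2 := by
  have := one_div_den_sq_le_one α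
  have h := Real.sq_sqrt (show 0 ≤ 9 / 4 - 1 / (α.den : ℝ) ^ 2 by linarith)
  unfold xRadius
  linear_combination -h

theorem xRadius_lt_half (α : ℚ) : xRadius α < 1 / 2 := by
  have h := one_div_den_sq_le_one α
  have : 1 < √(9 / 4 - 1 / (α.den : ℝ) ^ 2) := by
    rw [Real.lt_sqrt (by norm_num)]
    linarith
  unfold xRadius
  linarith

theorem xRadius_pos (α : ℚ) : 0 < xRadius α := by
  have h := one_div_den_sq_pos α
  rw [← xRadius_mul] at h
  have := xRadius_lt_half α
  exact pos_of_mul_pos_left h (by linarith)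

theorem mem_I_iff {α : ℚ} {x : ℝ} : x ∈ I α ↔ |x - α| < xRadius α := by
  rw [I, Set.mem_Ioo, abs_lt]
  constructor <;> rintro ⟨h1, h2⟩ <;> constructor <;> linarith

theorem self_mem_I (α : ℚ) : (α : ℝ) ∈ I α := by
  rw [mem_I_iff, sub_self, abs_zero]
  exact xRadius_pos α

theorem IsExcPair.sub_mul_real {α β : ℚ} (h : IsExcPair α β) :
    ((β : ℝ) - α) * (3 - (β - α)) = 1 / (α.den : ℝ) ^ 2 + 1 / (β.den : ℝ) ^ 2 := by
  have := congrArg (Rat.cast : ℚ → ℝ) h.sub_mul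
  push_cast at this
  exact this

/-- With f(x) = x(3 - x), f(β - α) = f(x_α) + f(x_β) exceeds f(x_α + x_β) by 2x_αx_β, and f
increases on [0, 3/2]. -/
theorem IsExcPair.add_xRadius_lt {α β : ℚ} (h : IsExcPair α β) :
    (α : ℝ) + xRadius α < β - xRadius β := by
  have h1 := h.sub_mul_real
  rw [← xRadius_mul, ← xRadius_mul] at h1
  have h2 : (β : ℝ) - α ≤ 1 := by exact_mod_cast h.sub_le_one
  have := xRadius_pos α
  have := xRadius_pos β
  have := xRadius_lt_half α
  have := xRadius_lt_half β
  by_contra! h3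
  nlinarith [mul_pos (xRadius_pos α) (xRadius_pos β), mul_nonneg
    (show 0 ≤ xRadius α + xRadius β - (β - α) by linarith)
    (show 0 ≤ 3 - (xRadius α + xRadius β) - (β - α) by linarith)]

theorem eps_add_xRadius_lt (q : ℕ) {i j : ℤ} (h : i < j) :
    (eps i q : ℝ) + xRadius (eps i q) < eps j q - xRadius (eps j q) := by
  induction j, h using Int.leInduction with
  | base => exact (isExcPair_eps i q).add_xRadius_lt
  | succ j hj ih =>
    have := (isExcPair_eps j q).add_xRadius_lt
    have := xRadius_pos (eps j q)
    linarith

theorem exists_common_level {α β : ℚ} (hα : α ∈ exceptionalSlopes)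
    (hβ : β ∈ exceptionalSlopes) : ∃ i j q, eps i q = α ∧ eps j q = β := by
  obtain ⟨p, q, rfl⟩ := hα
  obtain ⟨p', q', rfl⟩ := hβ
  exact ⟨2 ^ q' * p, 2 ^ q * p', q + q', eps_shift p q q',
    by rw [add_comm]; exact eps_shift p' q' q⟩

theorem add_xRadius_lt {α β : ℚ} (hα : α ∈ exceptionalSlopes)
    (hβ : β ∈ exceptionalSlopes) (h : α < β) : (α : ℝ) + xRadius α < β - xRadius β := by
  obtain ⟨i, j, q, rfl, rfl⟩ := exists_common_level hα hβ
  rcases lt_trichotomy i j with hij | rfl | hij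
  · exact eps_add_xRadius_lt q hij
  · exact absurd h (lt_irrefl _)
  · have h1 := eps_add_xRadius_lt q hij
    have := xRadius_pos (eps i q)
    have := xRadius_pos (eps j q)
    have : (eps i q : ℝ) < eps j q := by exact_mod_cast h
    linarith

theorem eq_of_mem_I {α β : ℚ} (hα : α ∈ exceptionalSlopes) (hβ : β ∈ exceptionalSlopes) {x : ℝ}
    (hxα : x ∈ I α) (hxβ : x ∈ I β) : α = β := by
  rcases lt_trichotomy α β with h | h | h
  · have := add_xRadius_lt hα hβ h
    linarith [hxα.2, hxβ.1]
  · exact h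
  · have := add_xRadius_lt hβ hα h
    linarith [hxβ.2, hxα.1]

theorem mem_cantorSet_iff {x : ℝ} : x ∈ cantorSet ↔ ∀ α ∈ exceptionalSlopes, x ∉ I α := by
  simp [cantorSet]

/-! ### Lipschitz continuity of `δ` and monotonicity of `γ` -/

/-- The factored form shows that δ exceeds 1/2 inside `I α` and tends to 1/2 at its endpoints. -/
theorem deltaReal_of_mem_I {α : ℚ} (hα : α ∈ exceptionalSlopes) {x : ℝ} (hx : x ∈ I α) :
    deltaReal x = 1 / 2 + (xRadius α - |x - α|) * (3 - xRadius α - |x - α|) / 2 := by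
  have h : ∃ α : ℚ, α ∈ exceptionalSlopes ∧ x ∈ I α := ⟨α, hα, hx⟩
  have e : assocSlope x h = α :=
    eq_of_mem_I (assocSlope_mem x h).1 hα (assocSlope_mem x h).2 hx
  have h2 : (disc α : ℝ) = (1 - xRadius α * (3 - xRadius α)) / 2 := by
    rw [xRadius_mul, disc]
    push_cast
    rfl
  rw [deltaReal, dif_pos h, e, h2, P]
  ring

theorem deltaReal_of_forall_notMem {x : ℝ} (hx : ¬∃ α ∈ exceptionalSlopes, x ∈ I α) :
    deltaReal x = 1 / 2 := by
  apply deltaReal_of_mem_cantorSet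
  rw [mem_cantorSet_iff]
  exact fun α hα h => hx ⟨α, hα, h⟩

theorem half_le_deltaReal (x : ℝ) : 1 / 2 ≤ deltaReal x := by
  by_cases h : ∃ α ∈ exceptionalSlopes, x ∈ I α
  · obtain ⟨α, hα, hx⟩ := h
    rw [deltaReal_of_mem_I hα hx]
    rw [mem_I_iff] at hx
    have := xRadius_lt_half α
    have := mul_nonneg (show 0 ≤ xRadius α - |x - α| by linarith)
      (show 0 ≤ 3 - xRadius α - |x - α| by linarith)
    linarith
  · rw [deltaReal_of_forall_notMem h]

theorem deltaReal_sub_le (x y : ℝ) : deltaReal x - deltaReal y ≤ 3 / 2 * |x - y| := by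
  by_cases h : ∃ α ∈ exceptionalSlopes, x ∈ I α
  · obtain ⟨α, hα, hx⟩ := h
    have h1 := xRadius_lt_half α
    have hx' := mem_I_iff.1 hx
    have h2 : |y - α| ≤ |x - α| + |x - y| := by
      have := abs_sub_le y x α
      rw [abs_sub_comm y x] at this
      linarith
    have h3 := abs_nonneg (x - α)
    have h4 := abs_nonneg (y - α)
    rw [deltaReal_of_mem_I hα hx]
    by_cases hy : y ∈ I α
    · rw [deltaReal_of_mem_I hα hy]
      rw [mem_I_iff] at hy
      have h5 := abs_nonneg (x - y)
      rcases le_total |y - α| |x - α| with h6 | h6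
      · nlinarith
      · nlinarith
    -- Outside `I α` only δ(y) ≥ 1/2 matters, since |x - y| is at least the distance from x to the
    -- boundary of `I α`.
    · rw [mem_I_iff, not_lt] at hy
      have := half_le_deltaReal y
      nlinarith [xRadius_pos α, mul_nonneg (sub_nonneg.2 hx'.le) (xRadius_pos α).le]
  · rw [deltaReal_of_forall_notMem h]
    have := half_le_deltaReal y
    have := abs_nonneg (x - y)
    linarith

theorem continuous_deltaReal : Continuous deltaReal := by
  refine (LipschitzWith.of_le_add_mul (3 / 2) fun x y => ?_).continuous
  have := deltaReal_sub_le x y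
  rw [Real.dist_eq]
  push_cast
  linarith

theorem continuous_gammaReal : Continuous gammaReal := by
  have := continuous_deltaReal
  unfold gammaReal P
  fun_prop

theorem strictMonoOn_gammaReal : StrictMonoOn gammaReal (Set.Ici 0) := by
  intro x hx y hy hxy
  rw [Set.mem_Ici] at hx hy
  have h := deltaReal_sub_le y x
  rw [abs_of_pos (sub_pos.2 hxy)] at h
  unfold gammaReal P
  nlinarith

theorem intCast_mem_exceptionalSlopes (n : ℤ) : (n : ℚ) ∈ exceptionalSlopes :=
  ⟨n, 0, eps_zero n⟩

theorem zero_mem_exceptionalSlopes : (0 : ℚ) ∈ exceptionalSlopes := by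
  simpa using intCast_mem_exceptionalSlopes 0

theorem gammaReal_zero : gammaReal 0 = 0 := by
  have h := xRadius_mul 0
  have h0 : (0 : ℝ) ∈ I 0 := by simpa using self_mem_I 0
  rw [gammaReal, P, deltaReal_of_mem_I zero_mem_exceptionalSlopes h0]
  simp at h ⊢
  linarith

theorem sq_div_two_le_gammaReal {x : ℝ} (hx : 0 ≤ x) : x ^ 2 / 2 ≤ gammaReal x := by
  have h := deltaReal_sub_le x 0
  have h0 := gammaReal_zero
  rw [sub_zero, abs_of_nonneg hx] at h
  unfold gammaReal P at *
  linarith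

theorem bijOn_gammaReal : Set.BijOn gammaReal (Set.Ici 0) (Set.Ici 0) := by
  refine ⟨fun x hx => ?_, strictMonoOn_gammaReal.injOn, fun y hy => ?_⟩
  · exact (by positivity : 0 ≤ x ^ 2 / 2).trans (sq_div_two_le_gammaReal hx)
  · rw [Set.mem_Ici] at hy
    have h1 : (0 : ℝ) ≤ y + 2 := by linarith
    have h2 := sq_div_two_le_gammaReal h1
    have h3 : y ∈ Set.Icc (gammaReal 0) (gammaReal (y + 2)) := by
      rw [gammaReal_zero]
      exact ⟨hy, by nlinarith⟩
    obtain ⟨x, hx, rfl⟩ := intermediate_value_Icc h1 continuous_gammaReal.continuousOn h3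
    exact ⟨x, hx.1, rfl⟩

theorem nonneg_of_mem_I {α : ℚ} (hα : α ∈ exceptionalSlopes) {x : ℝ} (hx0 : 0 ≤ x)
    (hx : x ∈ I α) : 0 ≤ α := by
  by_contra! h
  have h1 := add_xRadius_lt hα zero_mem_exceptionalSlopes h
  have := xRadius_pos 0
  push_cast at h1
  linarith [hx.2]

/-- On the right half of `I α` the affine function γ has slope α + 3, on the left half slope α; x ≥
0 ensures that the slope in play is nonzero. -/
theorem exists_ratCast_of_gammaReal_eq {α : ℚ} (hα : α ∈ exceptionalSlopes) {x : ℝ}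
    (hx0 : 0 ≤ x) (hx : x ∈ I α) {q : ℚ} (hq : gammaReal x = q) : ∃ μ : ℚ, (μ : ℝ) = x := by
  have h0 := nonneg_of_mem_I hα hx0 hx
  have h0' : (0 : ℝ) ≤ α := by exact_mod_cast h0
  have hm := xRadius_mul α
  rw [gammaReal, P, deltaReal_of_mem_I hα hx] at hq
  rcases le_or_gt (α : ℝ) x with h | h
  · rw [abs_of_nonneg (sub_nonneg.2 h)] at hq
    refine ⟨(2 * q - 1 + 1 / (α.den : ℚ) ^ 2 + α ^ 2 + 3 * α) / (2 * (α + 3)), ?_⟩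
    push_cast
    rw [← hm, ← hq]
    field_simp
    ring
  · rw [abs_of_neg (sub_neg.2 h)] at hq
    have hpos : (0 : ℝ) < α := by linarith
    refine ⟨(2 * q - 1 + 1 / (α.den : ℚ) ^ 2 + α ^ 2 - 3 * α) / (2 * α), ?_⟩
    push_cast
    rw [← hm, ← hq]
    field_simp
    ring

/-! ### Approximation of points of the Cantor set by exceptional slopes -/

/-- Two exceptional slopes that are neighbours at some level of the dyadic tree. -/
def IsAdjacent (α β : ℚ) : Prop := ∃ (p : ℤ) (q : ℕ), eps p q = α ∧ eps (p + 1) q = β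

/-- The points of the Cantor set that are not endpoints of some `I α`. -/
def innerCantorSet : Set ℝ :=
  {x | ∀ α ∈ exceptionalSlopes, xRadius α < |x - α|}

namespace IsAdjacent

variable {α β : ℚ}

theorem isExcPair (h : IsAdjacent α β) : IsExcPair α β := by
  obtain ⟨p, q, rfl, rfl⟩ := h
  exact isExcPair_eps p q

theorem left_mem (h : IsAdjacent α β) : α ∈ exceptionalSlopes := by
  obtain ⟨p, q, rfl, -⟩ := h
  exact ⟨p, q, rfl⟩

theorem right_mem (h : IsAdjacent α β) : β ∈ exceptionalSlopes := by
  obtain ⟨p, q, -, rfl⟩ := h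
  exact ⟨p + 1, q, rfl⟩

theorem dot_right (h : IsAdjacent α β) : IsAdjacent α (dot α β) := by
  obtain ⟨p, q, rfl, rfl⟩ := h
  exact ⟨2 * p, q + 1, eps_even p q, eps_odd p q⟩

theorem dot_left (h : IsAdjacent α β) : IsAdjacent (dot α β) β := by
  obtain ⟨p, q, rfl, rfl⟩ := h
  refine ⟨2 * p + 1, q + 1, eps_odd p q, ?_⟩
  rw [show 2 * p + 1 + 1 = 2 * (p + 1) by ring, eps_even]

theorem two_mul_left_le (h : IsAdjacent α β) : 2 * α.den ≤ (dot α β).den := by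
  have := h.isExcPair.two_mul_den_le
  have := Nat.mul_le_mul_left (2 * α.den) β.den_pos
  omega

theorem two_mul_right_le (h : IsAdjacent α β) : 2 * β.den ≤ (dot α β).den := by
  have := h.isExcPair.two_mul_den_le
  have := Nat.mul_le_mul_left (2 * β.den) α.den_pos
  nlinarith

theorem sub_sub_xRadius_le (h : IsAdjacent α β) :
    (β : ℝ) - α - xRadius α ≤ 1 / (β.den : ℝ) ^ 2 := by
  have h1 := h.isExcPair.sub_mul_real
  have h2 := h.isExcPair.add_xRadius_lt
  have h3 : (β : ℝ) - α ≤ 1 := by exact_mod_cast h.isExcPair.sub_le_one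
  rw [← xRadius_mul α] at h1
  have := xRadius_lt_half α
  have := xRadius_pos β
  nlinarith [mul_nonneg (show 0 ≤ (β : ℝ) - α - xRadius α by linarith)
    (show 0 ≤ 2 - (β - α : ℝ) - xRadius α by linarith)]

theorem sub_sub_xRadius_le' (h : IsAdjacent α β) :
    (β : ℝ) - α - xRadius β ≤ 1 / (α.den : ℝ) ^ 2 := by
  have h1 := h.isExcPair.sub_mul_real
  have h2 := h.isExcPair.add_xRadius_lt
  have h3 : (β : ℝ) - α ≤ 1 := by exact_mod_cast h.isExcPair.sub_le_one
  rw [← xRadius_mul β] at h1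
  have := xRadius_lt_half β
  have := xRadius_pos α
  nlinarith [mul_nonneg (show 0 ≤ (β : ℝ) - α - xRadius β by linarith)
    (show 0 ≤ 2 - (β - α : ℝ) - xRadius β by linarith)]

end IsAdjacent

variable {ξ : ℝ} {α β : ℚ}

theorem add_xRadius_lt_of_mem_inner (hξ : ξ ∈ innerCantorSet) (hα : α ∈ exceptionalSlopes)
    (h : (α : ℝ) ≤ ξ) : α + xRadius α < ξ := by
  have := hξ α hα
  rw [abs_of_nonneg (sub_nonneg.2 h)] at this
  linarith

theorem lt_sub_xRadius_of_mem_inner (hξ : ξ ∈ innerCantorSet) (hα : α ∈ exceptionalSlopes)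
    (h : ξ ≤ α) : ξ < α - xRadius α := by
  have := hξ α hα
  rw [abs_of_nonpos (sub_nonpos.2 h)] at this
  linarith

theorem lt_or_gt_of_mem_inner (hξ : ξ ∈ innerCantorSet) (hα : α ∈ exceptionalSlopes) :
    ξ < α ∨ (α : ℝ) < ξ := by
  refine lt_or_gt_of_ne ?_
  rintro rfl
  have := hξ α hα
  rw [sub_self, abs_zero] at this
  exact lt_asymm this (xRadius_pos α)

theorem one_div_den_sq_le_of_pow_le {n : ℕ} (h : 2 ^ n ≤ α.den) :
    1 / (α.den : ℝ) ^ 2 ≤ (1 / 2) ^ n := by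
  have h4 : (2 : ℝ) ^ n ≤ α.den := by exact_mod_cast h
  have h5 : (1 : ℝ) ≤ 2 ^ n := one_le_pow₀ (by norm_num)
  rw [one_div_pow]
  exact one_div_le_one_div_of_le (by positivity) (by nlinarith)

/-- If the left neighbour α never moved, the right neighbours would have unbounded denominators and
converge to α + x_α, below ξ. -/
theorem exists_left_doubled (hξ : ξ ∈ innerCantorSet) (h : IsAdjacent α β) (h1 : (α : ℝ) < ξ)
    (h2 : ξ < β) : ∃ α' β' : ℚ, IsAdjacent α' β' ∧ (α' : ℝ) < ξ ∧ ξ < β' ∧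
      2 * α.den ≤ α'.den ∧ β.den ≤ β'.den := by
  by_contra! hcon
  have key : ∀ n : ℕ, ∃ β' : ℚ, IsAdjacent α β' ∧ ξ < β' ∧ β.den ≤ β'.den ∧
      2 ^ n ≤ β'.den := by
    intro n
    induction n with
    | zero => exact ⟨β, h, h2, le_rfl, β.den_pos⟩
    | succ n ih =>
      obtain ⟨β', hadj, hβ', hle, hn⟩ := ih
      have h3 := hadj.two_mul_right_le
      rcases lt_or_gt_of_mem_inner hξ hadj.dot_left.left_mem with h4 | h4
      · exact ⟨_, hadj.dot_right, h4, by omega, by rw [pow_succ]; omega⟩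
      · have := hcon _ _ hadj.dot_left h4 hβ' hadj.two_mul_left_le
        omega
  have hpos := add_xRadius_lt_of_mem_inner hξ h.left_mem h1.le
  obtain ⟨n, hn⟩ := exists_pow_lt_of_lt_one (sub_pos.2 hpos) (show (1 / 2 : ℝ) < 1 by norm_num)
  obtain ⟨β', hadj, hβ', -, hle⟩ := key n
  have h3 := hadj.sub_sub_xRadius_le
  have h4 := one_div_den_sq_le_of_pow_le hle
  linarith

theorem exists_right_doubled (hξ : ξ ∈ innerCantorSet) (h : IsAdjacent α β) (h1 : (α : ℝ) < ξ)
    (h2 : ξ < β) : ∃ α' β' : ℚ, IsAdjacent α' β' ∧ (α' : ℝ) < ξ ∧ ξ < β' ∧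
      α.den ≤ α'.den ∧ 2 * β.den ≤ β'.den := by
  by_contra! hcon
  have key : ∀ n : ℕ, ∃ α' : ℚ, IsAdjacent α' β ∧ (α' : ℝ) < ξ ∧ α.den ≤ α'.den ∧
      2 ^ n ≤ α'.den := by
    intro n
    induction n with
    | zero => exact ⟨α, h, h1, le_rfl, α.den_pos⟩
    | succ n ih =>
      obtain ⟨α', hadj, hα', hle, hn⟩ := ih
      have h3 := hadj.two_mul_left_le
      rcases lt_or_gt_of_mem_inner hξ hadj.dot_left.left_mem with h4 | h4
      · have := hcon _ _ hadj.dot_right hα' h4 hle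
        have := hadj.two_mul_right_le
        omega
      · exact ⟨_, hadj.dot_left, h4, by omega, by rw [pow_succ]; omega⟩
  have hpos := lt_sub_xRadius_of_mem_inner hξ h.right_mem h2.le
  obtain ⟨n, hn⟩ := exists_pow_lt_of_lt_one (sub_pos.2 hpos) (show (1 / 2 : ℝ) < 1 by norm_num)
  obtain ⟨α', hadj, hα', -, hle⟩ := key n
  have h3 := hadj.sub_sub_xRadius_le'
  have h4 := one_div_den_sq_le_of_pow_le hle
  linarith

theorem exists_isAdjacent_pow_le (hξ : ξ ∈ innerCantorSet) (n : ℕ) :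
    ∃ α β : ℚ, IsAdjacent α β ∧ (α : ℝ) < ξ ∧ ξ < β ∧ 2 ^ n ≤ α.den ∧ 2 ^ n ≤ β.den := by
  induction n with
  | zero =>
    refine ⟨(⌊ξ⌋ : ℤ), (⌊ξ⌋ + 1 : ℤ), ⟨⌊ξ⌋, 0, rfl, rfl⟩, ?_, ?_, ?_, ?_⟩
    · rcases lt_or_gt_of_mem_inner hξ (intCast_mem_exceptionalSlopes ⌊ξ⌋) with h | h
      · push_cast at h
        exact absurd h (not_lt.2 (Int.floor_le ξ))
      · exact h
    · push_cast
      exact Int.lt_floor_add_one ξ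
    · exact Rat.den_pos _
    · exact Rat.den_pos _
  | succ n ih =>
    obtain ⟨α, β, h, h1, h2, h3, h4⟩ := ih
    obtain ⟨α', β', h', h1', h2', h3', h4'⟩ := exists_left_doubled hξ h h1 h2
    obtain ⟨α'', β'', h'', h1'', h2'', h3'', h4''⟩ := exists_right_doubled hξ h' h1' h2'
    exact ⟨α'', β'', h'', h1'', h2'', by rw [pow_succ]; omega, by rw [pow_succ]; omega⟩

theorem xRadius_le (α : ℚ) : xRadius α ≤ 1 / (α.den : ℝ) ^ 2 := by
  have := xRadius_mul α
  have := xRadius_pos α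
  have := xRadius_lt_half α
  nlinarith

/-- An inner point `ξ` of the Cantor set is approximated from below by exceptional slopes `α`
with `r_α → ∞` and `r_α² (ξ - α) → 1 / 3`. -/
theorem exists_tendsto_of_mem_inner (hξ : ξ ∈ innerCantorSet) :
    ∃ α : ℕ → ℚ, (∀ n, (α n : ℝ) < ξ) ∧ (∀ n, 2 ^ n ≤ (α n).den) ∧
      Tendsto (fun n => (α n : ℝ)) atTop (𝓝 ξ) ∧
      Tendsto (fun n => ((α n).den : ℝ) ^ 2 * (ξ - α n)) atTop (𝓝 (1 / 3)) := by
  choose α β h h1 h2 h3 h4 using exists_isAdjacent_pow_le hξ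
  have ht : Tendsto (fun n : ℕ => (1 / 2 : ℝ) ^ n) atTop (𝓝 0) :=
    tendsto_pow_atTop_nhds_zero_of_lt_one (by norm_num) (by norm_num)
  have hsub : ∀ n, (β n : ℝ) - α n ≤ 2 * (1 / 2) ^ n := by
    intro n
    have := (h n).sub_sub_xRadius_le
    have := xRadius_le (α n)
    have := one_div_den_sq_le_of_pow_le (h3 n)
    have := one_div_den_sq_le_of_pow_le (h4 n)
    linarith
  refine ⟨α, h1, h3, ?_, ?_⟩
  · refine tendsto_of_tendsto_of_tendsto_of_le_of_le (g := fun n => ξ - 2 * (1 / 2) ^ n)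
      (h := fun _ => ξ) ?_ tendsto_const_nhds (fun n => ?_) (fun n => (h1 n).le)
    · simpa using (ht.const_mul 2).const_sub ξ
    · have := hsub n
      have := h2 n
      dsimp only
      linarith
  · have hu : Tendsto (fun n : ℕ => 1 / (3 - 3 * (1 / 2 : ℝ) ^ n)) atTop (𝓝 (1 / 3)) := by
      have h5 := (ht.const_mul 3).const_sub 3
      rw [mul_zero, sub_zero] at h5
      exact tendsto_const_nhds.div h5 (by norm_num)
    refine tendsto_of_tendsto_of_tendsto_of_le_of_le' tendsto_const_nhds hu
      (Eventually.of_forall fun n => ?_) ?_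
    -- Lower bound: ξ - α > x_α and r_α² x_α ≥ 1/3.
    · have h5 := add_xRadius_lt_of_mem_inner hξ (h n).left_mem (h1 n).le
      have h6 := xRadius_mul (α n)
      have hr : (0 : ℝ) < (α n).den := by exact_mod_cast (α n).den_pos
      have h7 : ((α n).den : ℝ) ^ 2 * (xRadius (α n) * (3 - xRadius (α n))) = 1 := by
        rw [h6]; field_simp
      have h8 : ((α n).den : ℝ) ^ 2 * xRadius (α n) ≤ (α n).den ^ 2 * (ξ - α n) := by
        gcongr
        linarith
      have := mul_nonneg (sq_nonneg ((α n).den : ℝ)) (sq_nonneg (xRadius (α n)))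
      nlinarith
    · filter_upwards [eventually_ge_atTop 1] with n hn
      have hr : (0 : ℝ) < (α n).den := by exact_mod_cast (α n).den_pos
      have h5 := lt_sub_xRadius_of_mem_inner hξ (h n).right_mem (h2 n).le
      have h6 := xRadius_le (β n)
      have h7 := one_div_den_sq_le_of_pow_le (h4 n)
      have h8 := hsub n
      have h9 := (h n).isExcPair.sub_mul_real
      rw [← xRadius_mul (β n)] at h9
      have h10 : (1 / 2 : ℝ) ^ n ≤ 1 / 2 := by
        simpa using pow_le_pow_of_le_one (by norm_num : (0 : ℝ) ≤ 1 / 2) (by norm_num) hn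
      have h11 : 0 < 3 - 3 * (1 / 2 : ℝ) ^ n := by linarith
      rw [le_div_iff₀ h11]
      -- Upper bound: ξ - α < β - α - x_β, and the pair identity factors with this quantity times a
      -- factor tending to 3.
      have h12 : ((β n : ℝ) - α n - xRadius (β n)) * (3 - (β n - α n) - xRadius (β n)) =
          1 / ((α n).den : ℝ) ^ 2 := by linear_combination h9
      have h13 : (ξ - α n) * (3 - 3 * (1 / 2 : ℝ) ^ n) ≤ 1 / ((α n).den : ℝ) ^ 2 := by
        rw [← h12]
        have := h1 n
        exact mul_le_mul (by linarith) (by linarith) h11.le (by linarith)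
      calc _ = ((α n).den : ℝ) ^ 2 * ((ξ - α n) * (3 - 3 * (1 / 2 : ℝ) ^ n)) := by ring
        _ ≤ ((α n).den : ℝ) ^ 2 * (1 / ((α n).den : ℝ) ^ 2) := by gcongr
        _ = 1 := by field_simp

/-- For μ of denominator b, b r_α²(μ - α) is a positive multiple of r_α, so r_α²(μ - α) > 1 once r_α
> b, against the limit 1/3. -/
theorem ratCast_notMem_innerCantorSet (μ : ℚ) : (μ : ℝ) ∉ innerCantorSet := by
  intro hξ
  obtain ⟨α, h1, h2, -, h4⟩ := exists_tendsto_of_mem_inner hξ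
  have hb : (0 : ℝ) < μ.den := by exact_mod_cast μ.den_pos
  have h5 : ∀ᶠ n in atTop, ((α n).den : ℝ) ^ 2 * (μ - α n) < 1 :=
    h4.eventually_lt_const (by norm_num)
  obtain ⟨n, hn, hn'⟩ := (h5.and (eventually_ge_atTop μ.den)).exists
  have hr : (0 : ℝ) < (α n).den := by exact_mod_cast (α n).den_pos
  have e1 : (μ : ℝ) = μ.num / μ.den := by exact_mod_cast (Rat.num_div_den μ).symm
  have e2 : (α n : ℝ) = (α n).num / (α n).den := by
    exact_mod_cast (Rat.num_div_den (α n)).symm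
  have h6 : (0 : ℝ) < (μ.num * (α n).den - (α n).num * μ.den : ℤ) := by
    have := h1 n
    rw [e1, e2, div_lt_div_iff₀ hr hb] at this
    push_cast
    linarith
  have h7 : (1 : ℝ) ≤ (μ.num * (α n).den - (α n).num * μ.den : ℤ) := by
    have h6' : (0 : ℤ) < μ.num * (α n).den - (α n).num * μ.den := by exact_mod_cast h6
    exact_mod_cast h6'
  have h8 : ((α n).den : ℝ) ^ 2 * (μ - α n) * μ.den =
      (α n).den * (μ.num * (α n).den - (α n).num * μ.den : ℤ) := by
    rw [e1, e2]
    push_cast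
    field_simp
  have h9 : (μ.den : ℝ) < (α n).den := by
    exact_mod_cast hn'.trans_lt ((Nat.lt_two_pow_self).trans_le (h2 n))
  nlinarith

/-- A point `ξ` for which `ξ² + 3 ξ` is rational is not an inner point of the Cantor set. -/
theorem notMem_innerCantorSet_of_quadratic {c : ℚ} (hc : ξ ^ 2 + 3 * ξ = c) :
    ξ ∉ innerCantorSet := by
  intro hξ
  obtain ⟨α, -, -, h3, h4⟩ := exists_tendsto_of_mem_inner hξ
  have hN : (0 : ℝ) < c.den := by exact_mod_cast c.den_pos
  have e1 : (c : ℝ) * c.den = c.num := by exact_mod_cast c.mul_den_eq_num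
  have hlim : Tendsto (fun n => c.den * ((((α n).den : ℝ) ^ 2 * (ξ - α n)) * (α n + ξ + 3)))
      atTop (𝓝 (c.den * (1 / 3 * (ξ + ξ + 3)))) :=
    (h4.mul ((h3.add_const ξ).add_const 3)).const_mul _
  have hint : ∀ n, c.den * ((((α n).den : ℝ) ^ 2 * (ξ - α n)) * (α n + ξ + 3)) ∈
      Set.range ((↑) : ℤ → ℝ) := by
    intro n
    refine ⟨c.num * (α n).den ^ 2 - c.den * ((α n).num ^ 2 + 3 * (α n).num * (α n).den), ?_⟩
    have e2 : (α n : ℝ) * (α n).den = (α n).num := by exact_mod_cast (α n).mul_den_eq_num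
    push_cast
    rw [← e1, ← hc, ← e2]
    ring
  -- The terms are the integers N r_α²(c - α² - 3α), N the denominator of c, so their limit N(2ξ +
  -- 3)/3 is an integer.
  obtain ⟨m, hm⟩ := Int.isClosedEmbedding_coe_real.isClosed_range.mem_of_tendsto hlim
    (Eventually.of_forall hint)
  apply ratCast_notMem_innerCantorSet ((3 * m / c.den - 3) / 2)
  convert hξ
  push_cast
  rw [hm]
  field_simp
  ring

/-! ### Endpoints of the intervals `I α` -/

theorem irrational_sqrt_radius (α : ℚ) : Irrational √(9 / 4 - 1 / (α.den : ℝ) ^ 2) := by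
  have hr : (0 : ℝ) < α.den := by exact_mod_cast α.den_pos
  have h1 := one_div_den_sq_le_one α
  rintro ⟨s, hs⟩
  have h2 : (s : ℝ) ^ 2 = 9 / 4 - 1 / (α.den : ℝ) ^ 2 := by
    rw [hs, Real.sq_sqrt (by linarith)]
  have h3 : (2 * s * α.den) ^ 2 = ((9 * α.den ^ 2 - 4 : ℤ) : ℚ) := by
    have : (2 * s * α.den : ℝ) ^ 2 = 9 * α.den ^ 2 - 4 := by
      rw [mul_pow, mul_pow, h2]; field_simp; ring
    push_cast
    exact_mod_cast this
  have h4 : IsSquare ((9 * α.den ^ 2 - 4 : ℤ) : ℚ) := ⟨_, by rw [← h3, sq]⟩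
  rw [Rat.isSquare_intCast_iff] at h4
  obtain ⟨z, hz⟩ := h4
  have hr' : (1 : ℤ) ≤ α.den := by exact_mod_cast α.den_pos
  have hz' : (9 * (α.den : ℤ) ^ 2 - 4) = |z| * |z| := by rw [hz, abs_mul_abs_self]
  have hz0 := abs_nonneg z
  generalize |z| = w at *
  generalize (α.den : ℤ) = r at *
  have h5 : w < 3 * r := by nlinarith
  -- 9r² - 4 lies strictly between (3r - 2)² and (3r)², and equality with (3r - 1)² would give 6r =
  -- 5.
  rcases (show w = 3 * r - 1 ∨ w ≤ 3 * r - 2 by omega) with rfl | h6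
  · have : 6 * r = 5 := by linarith
    omega
  · nlinarith

/-- At the right and left endpoints, ξ² + 3ξ is a rational number plus -2(α + 3)S and 2αS
respectively, S being the irrational root. Nonnegativity of ξ keeps these coefficients nonzero; it
excludes the left endpoint of `I 0`. -/
theorem not_endpoint_of_quadratic {c : ℚ} (hξ : 0 ≤ ξ) (hc : ξ ^ 2 + 3 * ξ = c)
    (α : ℚ) : |ξ - α| ≠ xRadius α := by
  intro h
  have h1 := one_div_den_sq_le_one α
  have hS := Real.sq_sqrt (show 0 ≤ 9 / 4 - 1 / (α.den : ℝ) ^ 2 by linarith)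
  have hirr := irrational_sqrt_radius α
  have hx : xRadius α = 3 / 2 - √(9 / 4 - 1 / (α.den : ℝ) ^ 2) := rfl
  have hx2 := xRadius_lt_half α
  have hx0 := xRadius_pos α
  generalize √(9 / 4 - 1 / (α.den : ℝ) ^ 2) = S at *
  rcases le_total (α : ℝ) ξ with h2 | h2
  · rw [abs_of_nonneg (sub_nonneg.2 h2)] at h
    have hα3 : (0 : ℝ) < α + 3 := by linarith
    apply hirr
    refine ⟨((α + 3) ^ 2 + 9 / 4 - 1 / α.den ^ 2 - 9 / 4 - c) / (2 * (α + 3)), ?_⟩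
    push_cast
    rw [← hc, div_eq_iff (by positivity)]
    have e : ξ = α + 3 / 2 - S := by linarith
    rw [e]
    linear_combination -hS
  · rw [abs_of_nonpos (sub_nonpos.2 h2)] at h
    have hα0 : (0 : ℝ) < α := by linarith
    apply hirr
    refine ⟨(c + 9 / 4 - α ^ 2 - 9 / 4 + 1 / α.den ^ 2) / (2 * α), ?_⟩
    push_cast
    rw [← hc, div_eq_iff (by positivity)]
    have e : ξ = α - 3 / 2 + S := by linarith
    rw [e]
    linear_combination hS

theorem not_endpoint_of_ratCast (μ α : ℚ) : |(μ : ℝ) - α| ≠ xRadius α := by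
  intro h
  apply irrational_sqrt_radius α
  refine ⟨3 / 2 - |μ - α|, ?_⟩
  rw [xRadius] at h
  push_cast
  linarith

/-! ### Rational points and rational values of γ avoid the Cantor set -/

theorem mem_innerCantorSet_of_mem (hξ : ξ ∈ cantorSet)
    (h : ∀ α ∈ exceptionalSlopes, |ξ - α| ≠ xRadius α) : ξ ∈ innerCantorSet := by
  intro α hα
  have := mem_cantorSet_iff.1 hξ α hα
  rw [mem_I_iff, not_lt] at this
  exact this.lt_of_ne (h α hα).symm

theorem ratCast_notMem_cantorSet (μ : ℚ) : (μ : ℝ) ∉ cantorSet := fun h =>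
  ratCast_notMem_innerCantorSet μ
    (mem_innerCantorSet_of_mem h fun α _ => not_endpoint_of_ratCast μ α)

theorem notMem_cantorSet_of_gammaReal_eq (q : ℚ) (h0 : 0 ≤ ξ) (hq : gammaReal ξ = q) :
    ξ ∉ cantorSet := by
  intro h
  have hc : ξ ^ 2 + 3 * ξ = ((2 * q - 1 : ℚ) : ℝ) := by
    rw [gammaReal, deltaReal_of_mem_cantorSet h, P] at hq
    push_cast
    linarith
  exact notMem_innerCantorSet_of_quadratic hc
    (mem_innerCantorSet_of_mem h fun α _ => not_endpoint_of_quadratic h0 hc α)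

theorem exists_mem_I_of_notMem_cantorSet (h : ξ ∉ cantorSet) :
    ∃ α ∈ exceptionalSlopes, ξ ∈ I α := by
  simpa [cantorSet] using h

theorem bijOn_gamma : Set.BijOn gamma {μ : ℚ | 0 ≤ μ} {q : ℚ | 0 ≤ q} := by
  refine ⟨fun μ hμ => ?_, fun μ hμ ν hν h => ?_, fun q hq => ?_⟩
  · have hμ' : (0 : ℝ) ≤ μ := by exact_mod_cast hμ
    have := bijOn_gammaReal.mapsTo hμ'
    rw [gammaReal_ratCast, Set.mem_Ici] at this
    exact_mod_cast this
  · have hμ' : (0 : ℝ) ≤ μ := by exact_mod_cast hμ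
    have hν' : (0 : ℝ) ≤ ν := by exact_mod_cast hν
    have := bijOn_gammaReal.injOn hμ' hν'
      (by rw [gammaReal_ratCast, gammaReal_ratCast, h])
    exact_mod_cast this
  · have hq' : (0 : ℝ) ≤ q := by exact_mod_cast hq
    obtain ⟨x, hx, hxq⟩ := bijOn_gammaReal.surjOn hq'
    obtain ⟨α, hα, hxα⟩ :=
      exists_mem_I_of_notMem_cantorSet (notMem_cantorSet_of_gammaReal_eq q hx hxq)
    obtain ⟨μ, rfl⟩ := exists_ratCast_of_gammaReal_eq hα hx hxα hxq
    refine ⟨μ, Rat.cast_nonneg.1 (Set.mem_Ici.1 hx), ?_⟩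
    rw [gammaReal_ratCast] at hxq
    exact_mod_cast hxq

end ExceptionalSlopes

theorem mainTheorem4 :
    -- each rational number has exactly one associated exceptional slope, so `δ` is well defined
    (∀ μ : ℚ, ∃! α : ℚ, α ∈ ExceptionalSlopes.exceptionalSlopes ∧
      (μ : ℝ) ∈ ExceptionalSlopes.I α) ∧
    -- `γ` is a bijection from the nonnegative rationals to the nonnegative rationals
    Set.BijOn ExceptionalSlopes.gamma {μ : ℚ | 0 ≤ μ} {q : ℚ | 0 ≤ q} ∧
    -- its extension to the nonnegative reals is continuous and bijective
    ContinuousOn ExceptionalSlopes.gammaReal (Set.Ici 0) ∧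
    Set.BijOn ExceptionalSlopes.gammaReal (Set.Ici 0) (Set.Ici 0) ∧
    -- the preimage of a nonnegative rational never lies in the generalized Cantor set
    (∀ q : ℚ, 0 ≤ q → ∀ ξ : ℝ, 0 ≤ ξ → ExceptionalSlopes.gammaReal ξ = (q : ℝ) →
      ξ ∉ ExceptionalSlopes.cantorSet) := by
  refine ⟨fun μ => ?_, ExceptionalSlopes.bijOn_gamma,
    ExceptionalSlopes.continuous_gammaReal.continuousOn, ExceptionalSlopes.bijOn_gammaReal,
    fun q _ ξ hξ hq => ExceptionalSlopes.notMem_cantorSet_of_gammaReal_eq q hξ hq⟩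
  obtain ⟨α, hα, hμ⟩ := ExceptionalSlopes.exists_mem_I_of_notMem_cantorSet
    (ExceptionalSlopes.ratCast_notMem_cantorSet μ)
  exact ⟨α, ⟨hα, hμ⟩, fun β hβ => ExceptionalSlopes.eq_of_mem_I hβ.1 hα hβ.2 hμ⟩
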